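/- Let $n\ge 0$ and $b\ge 1$ be integers. In the monotone $b$-biased Oriented-cycle game on the complete graph $K_n$, two players, OMaker and OBreaker, alternately direct edges of $K_n$ that have not been directed before, with OMaker moving first: on each turn OMaker directs exactly one undirected edge, and OBreaker directs at least $1$ and at most $b$ undirected edges. The game ends as soon as all edges are directed. OMaker wins if the resulting tournament contains a directed cycle, and OBreaker wins if it is acyclic. The threshold bias $t(n,\mathcal{C})$ is the largest integer $b\ge 1$ for which OMaker has a winning strategy, and $t(n,\mathcal{C})=0$ if there is no such $b$. Theorem. There is an absolute constant $C$ such that the following holds for every $n$. For all integers $b\ge 1$, OMaker has a winning strategy in the monotone $b$-biased Oriented-cycle game on $K_n$ if and only if $b\le t(n,\mathcal{C})$; moreover $$t(n,\mathcal{C})\le 0.7845\,n+C ,$$ and OBreaker has a winning strategy (that is, can keep the final tournament acyclic) for every integer $b\ge 1$ with $b\ge 0.7845\,n+C$. -/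

import Mathlib

namespace OrientationGame

/-- A digraph on the vertex set `Fin n`, given by its set of arcs: `(v, w)` is the arc from `v`
to `w`. It is the position of an orientation game: the arcs directed so far by both players. -/
abbrev Position (n : ℕ) : Type := Finset (Fin n × Fin n)

/-- The available arcs of `D`: the pairs `(v, w)` with `v ≠ w` such that neither `(v, w)` nor its
reverse `(w, v)` lies in `D`. -/
def available {n : ℕ} (D : Position n) : Finset (Fin n × Fin n) :=
  Finset.univ.filter fun e => e.1 ≠ e.2 ∧ e ∉ D ∧ e.swap ∉ D

/-- A legal move in position `D` under monotone rules with bias `m`: a player directs at least one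
and at most `m` previously undirected edges, each of them in one direction only. -/
def IsLegalMove {n : ℕ} (m : ℕ) (D S : Position n) : Prop :=
  S ⊆ available D ∧ (∀ e ∈ S, e.swap ∉ S) ∧ 1 ≤ S.card ∧ S.card ≤ m

/-- The two players. -/
inductive Player : Type
  | OMaker
  | OBreaker

/-- The other player. -/
def Player.opponent : Player → Player
  | .OMaker => .OBreaker
  | .OBreaker => .OMaker

/-- The number of edges that a player may direct per turn in the `(a : b)` biased game. -/
def Player.bias (a b : ℕ) : Player → ℕ
  | .OMaker => a
  | .OBreaker => b

/-- The outcome of a finished play with final tournament `T`: OMaker wins if `T` has the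
property `P`, and OBreaker wins otherwise. -/
def Player.winsFinal {n : ℕ} (P : Position n → Prop) (T : Position n) : Player → Prop
  | .OMaker => P T
  | .OBreaker => ¬ P T

/-- `HasWinningStrategy P a b p q D`: in the `(a : b)` biased orientation game on `K_n` with
property `P` under monotone rules, player `p` has a winning strategy from position `D` when it is
the turn of player `q`. The play is over as soon as no edge is left undirected; before that, `p`
has to have a good move on the turns of `p`, and to be able to answer every legal move on the turns
of the opponent. -/
inductive HasWinningStrategy {n : ℕ} (P : Position n → Prop) (a b : ℕ) (p : Player) :
    Player → Position n → Prop
  | finished (q : Player) (D : Position n) (hD : available D = ∅) (h : p.winsFinal P D) :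
      HasWinningStrategy P a b p q D
  | ownTurn (q : Player) (D S : Position n) (hq : q = p) (hD : available D ≠ ∅)
      (hS : IsLegalMove (q.bias a b) D S)
      (h : HasWinningStrategy P a b p q.opponent (D ∪ S)) :
      HasWinningStrategy P a b p q D
  | opponentTurn (q : Player) (D : Position n) (hq : q ≠ p) (hD : available D ≠ ∅)
      (h : ∀ S : Position n, IsLegalMove (q.bias a b) D S →
        HasWinningStrategy P a b p q.opponent (D ∪ S)) :
      HasWinningStrategy P a b p q D

/-- `D` contains a directed cycle: there are distinct vertices `f 0, …, f k` such that
`(f 0, f 1), …, (f (k - 1), f k)` and `(f k, f 0)` are arcs of `D`. The addition `i + 1` in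
`Fin (k + 1)` is cyclic, so that `i + 1 = 0` for the last index `i`. -/
def HasDirectedCycle {n : ℕ} (D : Position n) : Prop :=
  ∃ (k : ℕ) (f : Fin (k + 1) → Fin n), Function.Injective f ∧
    ∀ i : Fin (k + 1), (f i, f (i + 1)) ∈ D

/-- OMaker, who moves first, has a winning strategy in the monotone `b`-biased Oriented-cycle game
on `K_n`. -/
def OMakerWins (n b : ℕ) : Prop :=
  HasWinningStrategy (n := n) HasDirectedCycle 1 b .OMaker .OMaker ∅

/-- OBreaker, who moves second, has a winning strategy in the monotone `b`-biased Oriented-cycle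
game on `K_n`: OBreaker can keep the final tournament acyclic. -/
def OBreakerWins (n b : ℕ) : Prop :=
  HasWinningStrategy (n := n) HasDirectedCycle 1 b .OBreaker .OMaker ∅

/-- The threshold bias `t(n, 𝒞)` of the monotone Oriented-cycle game on `K_n`: the largest bias
`b ≥ 1` for which OMaker wins (and `0` if there is none). -/
noncomputable def thresholdBias (n : ℕ) : ℕ :=
  sSup {b : ℕ | 1 ≤ b ∧ OMakerWins n b}

end OrientationGame

/-!
OBreaker keeps the position an interval order: every vertex `v` carries an interval `(l v, u v)`,
and `(v, w)` is directed exactly when the interval of `v` ends no later than that of `w` begins.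
Such a position is acyclic. When OMaker directs `(x, y)`, the intervals of `x` and `y` overlap, and
OBreaker cuts them at a common point `p`, so that `x` ends and `y` begins at `p`
(`cut_subset_card`). The arcs this requires lead from intervals on the left of `p` to `y` and
from `x` to intervals on the right of `p`, so their number is at most the number of intervals
missing `p`; and since any other point is newly missed by at most one of `x` and `y`, the number of
intervals missing a given point grows by at most one through such an answer.

With the rest of the budget, OBreaker splits the vertices into a left side of `a` and a right side
of `c` vertices, separated by the origin. All intervals contain the origin at first. Moving an
undecided vertex to the right costs at most `a` arcs and makes it miss the negative points; moving
it to the left costs at most `c` arcs and makes it miss the positive ones. The positive points are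
thus missed by at most `P` and the negative ones by at most `Q` intervals, where `P + Q = N + r`
after `r` rounds with `N = a + c` decided vertices, and OBreaker keeps `P` and `Q` balanced
(`IsBalanced`). The answer to OMaker's arc then costs about `(N + r) / 2` and decides one vertex.
A pair of further vertices, one for each side, costs about `a + c = N`, whatever the sizes of the
two sides are, and a single further vertex costs at most about `(N + r) / 2` (`roundCost`). Once all
vertices are decided, each side plays for itself, and a cut costs less than the size of the
side (`IsDecided.exists_answer`).

It remains to see that all vertices are decided while `(N + r) / 2` is still below the bias, that
is, within about `0.569 n` rounds for the bias `0.7845 n`. When `N` and `r` are small, OBreaker can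
afford six vertices per round, later only five, and so on. Solving the resulting recursion gives a
piecewise linear lower bound for `N` in terms of `r` (`offset`, `IsSafe`), which is maintained by
`exists_affordable_round`.

The threshold property follows since a smaller bias only helps OMaker, and since the two players
cannot both have a winning strategy.
-/

namespace OrientationGame

/-! ### Interval orders -/

/-- The interval order of the open intervals `(l v, u v)`: `v` lies before `w` when the interval
of `v` ends no later than that of `w` begins. -/
noncomputable def intervalOrder {n : ℕ} (l u : Fin n → ℝ) : Position n :=
  Finset.univ.filter fun e => u e.1 ≤ l e.2

lemma mem_intervalOrder {n : ℕ} {l u : Fin n → ℝ} {e : Fin n × Fin n} :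
    e ∈ intervalOrder l u ↔ u e.1 ≤ l e.2 := by
  simp [intervalOrder]

lemma mem_available {n : ℕ} {D : Position n} {e : Fin n × Fin n} :
    e ∈ available D ↔ e.1 ≠ e.2 ∧ e ∉ D ∧ e.swap ∉ D := by
  simp [available]

lemma not_hasDirectedCycle_of_subset {n : ℕ} {l u : Fin n → ℝ} (hlt : ∀ v, l v < u v)
    {D : Position n} (hD : D ⊆ intervalOrder l u) : ¬ HasDirectedCycle D := by
  rintro ⟨k, f, -, hf⟩
  obtain ⟨i, hi⟩ := Finite.exists_max fun i => u (f i)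
  have h1 := mem_intervalOrder.1 (hD (hf i))
  have h2 := hi (i + 1)
  have h3 := hlt (f (i + 1))
  simp only at h1 h2
  linarith

lemma isLegalMove_sdiff {n : ℕ} {l u : Fin n → ℝ} (hlt : ∀ v, l v < u v) {D : Position n}
    (hD : D ⊆ intervalOrder l u) (hne : intervalOrder l u ≠ D) {m : ℕ}
    (hm : (intervalOrder l u).card ≤ D.card + m) :
    IsLegalMove m D (intervalOrder l u \ D) := by
  have asymm : ∀ e ∈ intervalOrder l u, e.swap ∉ intervalOrder l u := by
    intro e he he'
    have h1 := mem_intervalOrder.1 he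
    have h2 := mem_intervalOrder.1 he'
    simp only [Prod.fst_swap, Prod.snd_swap] at h2
    linarith [hlt e.1, hlt e.2]
  have hcard := Finset.card_sdiff_add_card_eq_card hD
  refine ⟨fun e he => ?_, fun e he he' => ?_, ?_, by omega⟩
  · rw [Finset.mem_sdiff] at he
    refine mem_available.2 ⟨fun h => ?_, he.2, fun h => asymm e he.1 (hD h)⟩
    have h1 := mem_intervalOrder.1 he.1
    rw [h] at h1
    exact absurd (hlt e.2) (not_lt.2 h1)
  · exact asymm e (Finset.mem_sdiff.1 he).1 (Finset.mem_sdiff.1 he').1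
  · rw [Nat.one_le_iff_ne_zero, Finset.card_ne_zero, Finset.sdiff_nonempty]
    exact fun h => hne (h.antisymm hD)

lemma lt_of_mem_available {n : ℕ} {l u : Fin n → ℝ} {x y : Fin n}
    (h : (x, y) ∈ available (intervalOrder l u)) : x ≠ y ∧ l y < u x ∧ l x < u y := by
  obtain ⟨h1, h2, h3⟩ := mem_available.1 h
  rw [mem_intervalOrder, not_le] at h2 h3
  exact ⟨h1, h2, h3⟩

/-- A point of `(s, t)` that is not an endpoint of any of the intervals. -/
lemma exists_generic_point {n : ℕ} (l u : Fin n → ℝ) {s t : ℝ} (h : s < t) :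
    ∃ p, s < p ∧ p < t ∧ ∀ z, l z ≠ p ∧ u z ≠ p := by
  obtain ⟨p, hp, hp'⟩ := (Set.Ioo_infinite h).exists_notMem_finset
    (Finset.univ.image l ∪ Finset.univ.image u)
  refine ⟨p, hp.1, hp.2, fun z => ⟨?_, ?_⟩⟩ <;> rintro rfl <;> simp at hp'

/-- Cutting at a common point `p` of the intervals of `x` and `y`: the interval of `x` now ends at
`p`, and that of `y` begins there. This puts `x` before `y`, and otherwise it only adds arcs
into `y` from intervals that end before `p`, and arcs from `x` to intervals that begin
after `p`. -/
lemma cut_subset_card {n : ℕ} {l u : Fin n → ℝ} {x y : Fin n} (hxy : x ≠ y) {p : ℝ}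
    (hlx : l x < p) (hly : l y < p) (hux : p < u x) (huy : p < u y)
    (hp : ∀ z, l z ≠ p ∧ u z ≠ p) :
    insert (x, y) (intervalOrder l u) ⊆
      intervalOrder (Function.update l y p) (Function.update u x p) ∧
    (intervalOrder (Function.update l y p) (Function.update u x p)).card ≤
      (intervalOrder l u).card + 1 +
        ((Finset.univ.filter fun z => z ≠ x ∧ z ≠ y ∧ l y < u z ∧ u z < p).card +
          (Finset.univ.filter fun z => z ≠ x ∧ z ≠ y ∧ p < l z ∧ l z < u x).card) := by
  constructor
  · intro e he
    rw [mem_intervalOrder]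
    rcases Finset.mem_insert.1 he with rfl | he
    · simp
    · have h := mem_intervalOrder.1 he
      have h1 : Function.update u x p e.1 ≤ u e.1 := by
        rw [Function.update_apply]; split_ifs with h1
        · rw [h1]; exact hux.le
        · exact le_rfl
      have h2 : l e.2 ≤ Function.update l y p e.2 := by
        rw [Function.update_apply]; split_ifs with h2
        · rw [h2]; exact hly.le
        · exact le_rfl
      linarith
  · set U := Finset.univ.filter fun z => z ≠ x ∧ z ≠ y ∧ l y < u z ∧ u z < p
    set L := Finset.univ.filter fun z => z ≠ x ∧ z ≠ y ∧ p < l z ∧ l z < u x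
    have hsub : intervalOrder (Function.update l y p) (Function.update u x p) ⊆
        insert (x, y) (intervalOrder l u) ∪ (U.image (fun z => (z, y)) ∪
          L.image (fun z => (x, z))) := by
      rintro ⟨v, w⟩ he
      rw [mem_intervalOrder] at he
      simp only [Function.update_apply] at he
      simp only [Finset.mem_union, Finset.mem_insert, Finset.mem_image, mem_intervalOrder,
        Prod.mk.injEq, U, L, Finset.mem_filter, Finset.mem_univ, true_and]
      by_cases hv : v = x
      · subst hv
        by_cases hw : w = y
        · exact Or.inl (Or.inl ⟨rfl, hw⟩)
        · rw [if_pos rfl, if_neg hw] at he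
          by_cases hc : u v ≤ l w
          · exact Or.inl (Or.inr hc)
          · have h1 : p < l w := lt_of_le_of_ne he (hp w).1.symm
            refine Or.inr (Or.inr ⟨w, ⟨?_, hw, h1, not_le.1 hc⟩, rfl, rfl⟩)
            rintro rfl
            linarith
      · rw [if_neg hv] at he
        by_cases hw : w = y
        · subst hw
          rw [if_pos rfl] at he
          by_cases hc : u v ≤ l w
          · exact Or.inl (Or.inr hc)
          · have h1 : u v < p := lt_of_le_of_ne he (hp v).2
            refine Or.inr (Or.inl ⟨v, ⟨hv, ?_, not_le.1 hc, h1⟩, rfl, rfl⟩)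
            rintro rfl
            linarith
        · rw [if_neg hw] at he
          exact Or.inl (Or.inr he)
    calc _ ≤ _ := Finset.card_le_card hsub
      _ ≤ _ := Finset.card_union_le _ _
      _ ≤ _ := Nat.add_le_add (Finset.card_insert_le _ _)
        ((Finset.card_union_le _ _).trans
          (Nat.add_le_add Finset.card_image_le Finset.card_image_le))

lemma cut_lt {n : ℕ} {l u : Fin n → ℝ} (hlt : ∀ v, l v < u v) {x y : Fin n} (hxy : x ≠ y) {p : ℝ}
    (hlx : l x < p) (huy : p < u y) (v : Fin n) :
    Function.update l y p v < Function.update u x p v := by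
  simp only [Function.update_apply]
  split_ifs with h1 h2 h2
  · exact absurd (h2.symm.trans h1) hxy
  · rw [h1]; exact huy
  · rw [h2]; exact hlx
  · exact hlt v

/-! ### Splitting the vertices at the origin -/

/-- The number of closed intervals `[l z, u z]` that miss the point `t`. -/
noncomputable def missCount {n : ℕ} (l u : Fin n → ℝ) (t : ℝ) : ℕ :=
  (Finset.univ.filter fun z => u z < t).card + (Finset.univ.filter fun z => t < l z).card

/-- The intervals lie in `(-1, 1)`, there are `a` of them to the left of the origin and `c` to the
right, every point of `(0, 1)` is missed by at most `P` intervals, and every point of `(-1, 0)` by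
at most `Q`. The vertices
whose interval contains the origin are still undecided between the two sides. -/
structure IsSplit {n : ℕ} (l u : Fin n → ℝ) (a c P Q : ℕ) : Prop where
  lt : ∀ v, l v < u v
  left : (Finset.univ.filter fun z => u z ≤ 0).card = a
  right : (Finset.univ.filter fun z => 0 ≤ l z).card = c
  bounds : ∀ v, -1 ≤ l v ∧ u v ≤ 1
  pos : ∀ t, 0 < t → t < 1 → missCount l u t ≤ P
  neg : ∀ t, t < 0 → -1 < t → missCount l u t ≤ Q

section Reverse

variable {n : ℕ} {l u : Fin n → ℝ} {a c P Q : ℕ}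

lemma missCount_neg (t : ℝ) : missCount (-u) (-l) t = missCount l u (-t) := by
  unfold missCount
  rw [add_comm]
  congr 3 <;> ext z <;> simp only [Pi.neg_apply]
  · rw [lt_neg]
  · rw [neg_lt]

lemma IsSplit.reverse (h : IsSplit l u a c P Q) : IsSplit (-u) (-l) c a Q P where
  lt v := neg_lt_neg (h.lt v)
  left := by rw [← h.right]; simp
  right := by rw [← h.left]; simp
  bounds v := ⟨neg_le_neg (h.bounds v).2, neg_le.1 (h.bounds v).1⟩
  pos t ht ht' := by rw [missCount_neg]; exact h.neg _ (by linarith) (by linarith)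
  neg t ht ht' := by rw [missCount_neg]; exact h.pos _ (by linarith) (by linarith)

lemma intervalOrder_reverse :
    intervalOrder (-u) (-l) = (intervalOrder l u).image Prod.swap := by
  ext ⟨v, w⟩
  simp only [mem_intervalOrder, Finset.mem_image, Prod.exists, Prod.swap_prod_mk, Prod.mk.injEq,
    Pi.neg_apply, neg_le_neg_iff]
  constructor
  · exact fun h => ⟨w, v, h, rfl, rfl⟩
  · rintro ⟨_, _, h, rfl, rfl⟩
    exact h

lemma card_intervalOrder_reverse :
    (intervalOrder (-u) (-l)).card = (intervalOrder l u).card := by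
  rw [intervalOrder_reverse, Finset.card_image_of_injective _ Prod.swap_injective]

lemma swap_mem_intervalOrder_reverse {e : Fin n × Fin n} :
    e.swap ∈ intervalOrder (-u) (-l) ↔ e ∈ intervalOrder l u := by
  simp [mem_intervalOrder]

lemma intervalOrder_reverse_subset {l' u' : Fin n → ℝ}
    (h : intervalOrder (-u) (-l) ⊆ intervalOrder l' u') :
    intervalOrder l u ⊆ intervalOrder (-u') (-l') := by
  intro e he
  rw [← swap_mem_intervalOrder_reverse] at he
  have := swap_mem_intervalOrder_reverse.2 (h he)
  simpa using this

end Reverse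

section Split

variable {n : ℕ} {l u : Fin n → ℝ} {a c P Q : ℕ}

lemma IsSplit.left_le (h : IsSplit l u a c P Q) : a ≤ P := by
  obtain ⟨p, hp0, hp1, -⟩ := exists_generic_point l u (zero_lt_one' ℝ)
  rw [← h.left]
  refine le_trans ?_ (h.pos p hp0 hp1)
  refine le_trans (Finset.card_le_card fun z hz => ?_) (Nat.le_add_right _ _)
  simp only [Finset.mem_filter, Finset.mem_univ, true_and] at hz ⊢
  linarith

lemma IsSplit.right_le (h : IsSplit l u a c P Q) : c ≤ Q := h.reverse.left_le

lemma IsSplit.left_add_right_le (h : IsSplit l u a c P Q) : a + c ≤ n := by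
  rw [← h.left, ← h.right, ← Finset.card_union_of_disjoint]
  · simpa using Finset.card_le_univ (α := Fin n) _
  · rw [Finset.disjoint_filter]
    intro z _ h1 h2
    linarith [h.lt z]

lemma IsSplit.eq_or_exists (h : IsSplit l u a c P Q) : a + c = n ∨ ∃ v, l v < 0 ∧ 0 < u v := by
  by_contra! hc
  apply hc.1
  rw [← h.left, ← h.right, ← Finset.card_union_of_disjoint]
  · rw [← Finset.filter_or, Finset.filter_true_of_mem]
    · simp
    · intro z _
      by_cases hz : l z < 0
      · exact Or.inl (hc.2 z hz)
      · exact Or.inr (not_lt.1 hz)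
  · rw [Finset.disjoint_filter]
    intro z _ h1 h2
    linarith [h.lt z]

/-- An undecided vertex can be moved to the right side at the price of at most one arc from each
vertex of the left side. -/
lemma IsSplit.exists_move_right (h : IsSplit l u a c P Q) {v : Fin n} (hl : l v < 0)
    (hu : 0 < u v) : ∃ l' u' : Fin n → ℝ, IsSplit l' u' a (c + 1) P (Q + 1) ∧
      intervalOrder l u ⊆ intervalOrder l' u' ∧
      (intervalOrder l' u').card ≤ (intervalOrder l u).card + a := by
  refine ⟨Function.update l v 0, u, ⟨fun z => ?_, h.left, ?_, fun z => ?_, fun t ht ht' => ?_,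
    fun t ht ht' => ?_⟩, fun e he => ?_, ?_⟩
  · rw [Function.update_apply]; split_ifs with hz
    · rw [hz]; exact hu
    · exact h.lt z
  · have : (Finset.univ.filter fun z => 0 ≤ Function.update l v 0 z) =
        insert v (Finset.univ.filter fun z => 0 ≤ l z) := by
      ext z
      simp only [Finset.mem_filter, Finset.mem_univ, true_and, Finset.mem_insert,
        Function.update_apply]
      split_ifs with hz <;> simp [hz]
    rw [this, Finset.card_insert_of_notMem (by simpa using hl), h.right]
  · refine ⟨?_, (h.bounds z).2⟩
    rw [Function.update_apply]; split_ifs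
    · norm_num
    · exact (h.bounds z).1
  · refine le_trans (Nat.add_le_add le_rfl (Finset.card_le_card fun z hz => ?_)) (h.pos t ht ht')
    simp only [Finset.mem_filter, Finset.mem_univ, true_and, Function.update_apply] at hz ⊢
    split_ifs at hz
    · linarith
    · exact hz
  · have hs : (Finset.univ.filter fun z => t < Function.update l v 0 z) ⊆
        insert v (Finset.univ.filter fun z => t < l z) := by
      intro z hz
      simp only [Finset.mem_filter, Finset.mem_univ, true_and, Finset.mem_insert,
        Function.update_apply] at hz ⊢
      split_ifs at hz with h1
      · exact Or.inl h1
      · exact Or.inr hz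
    have h1 := (Finset.card_le_card hs).trans (Finset.card_insert_le _ _)
    have h2 := h.neg t ht ht'
    unfold missCount at h2 ⊢
    omega
  · rw [mem_intervalOrder] at he ⊢
    rw [Function.update_apply]; split_ifs with hz
    · rw [hz] at he; linarith
    · exact he
  · have hs : intervalOrder (Function.update l v 0) u ⊆ intervalOrder l u ∪
        (Finset.univ.filter fun z => u z ≤ 0).image (fun z => (z, v)) := by
      rintro ⟨z, w⟩ he
      simp only [Finset.mem_union, mem_intervalOrder, Finset.mem_image, Finset.mem_filter,
        Finset.mem_univ, true_and, Prod.mk.injEq, Function.update_apply] at he ⊢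
      split_ifs at he with hw
      · exact Or.inr ⟨z, he, rfl, hw.symm⟩
      · exact Or.inl he
    refine (Finset.card_le_card hs).trans ((Finset.card_union_le _ _).trans ?_)
    rw [← h.left]
    exact Nat.add_le_add le_rfl Finset.card_image_le

lemma IsSplit.exists_move_left (h : IsSplit l u a c P Q) {v : Fin n} (hl : l v < 0)
    (hu : 0 < u v) : ∃ l' u' : Fin n → ℝ, IsSplit l' u' (a + 1) c (P + 1) Q ∧
      intervalOrder l u ⊆ intervalOrder l' u' ∧
      (intervalOrder l' u').card ≤ (intervalOrder l u).card + c := by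
  obtain ⟨l', u', h1, h2, h3⟩ := h.reverse.exists_move_right (v := v) (by simpa using hu)
    (by simpa using hl)
  refine ⟨-u', -l', h1.reverse, intervalOrder_reverse_subset h2, ?_⟩
  rwa [card_intervalOrder_reverse, ← card_intervalOrder_reverse (l := l) (u := u)]

/-- Answering the arc `(x, y)` by a cut at a positive point: the number of intervals missing a
given positive point grows by at most one. If `y` was undecided, it is moved to the right side;
otherwise no arcs out of the left side are needed. -/
lemma IsSplit.exists_cut_pos (h : IsSplit l u a c P Q) {x y : Fin n} (hxy : x ≠ y)
    (h1 : l y < u x) (h2 : l x < u y) (hx : 0 < u x) (hy : 0 < u y) :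
    ∃ l' u' : Fin n → ℝ, insert (x, y) (intervalOrder l u) ⊆ intervalOrder l' u' ∧
      ((IsSplit l' u' a (c + 1) (P + 1) (Q + 1) ∧
          (intervalOrder l' u').card ≤ (intervalOrder l u).card + 1 + P) ∨
        (IsSplit l' u' a c (P + 1) Q ∧
          (intervalOrder l' u').card + a ≤ (intervalOrder l u).card + 1 + P)) := by
  have hI : max (max (l x) (l y)) 0 < min (u x) (u y) := by
    simp only [max_lt_iff, lt_min_iff]
    exact ⟨⟨⟨h.lt x, h1⟩, hx⟩, ⟨h2, h.lt y⟩, hy⟩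
  obtain ⟨p, hp1, hp2, hp⟩ := exists_generic_point l u hI
  simp only [max_lt_iff, lt_min_iff] at hp1 hp2
  obtain ⟨⟨hlx, hly⟩, hp0⟩ := hp1
  obtain ⟨hux, huy⟩ := hp2
  obtain ⟨hsub, hcard⟩ := cut_subset_card hxy hlx hly hux huy hp
  set l' := Function.update l y p with hl'
  set u' := Function.update u x p with hu'
  have hlt : ∀ v, l' v < u' v := cut_lt h.lt hxy hlx huy
  have hleft : (Finset.univ.filter fun z => u' z ≤ 0).card = a := by
    rw [← h.left]
    congr 2
    ext z
    simp only [hu', Function.update_apply]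
    split_ifs with hz
    · rw [hz]; constructor <;> intro _ <;> linarith
    · rfl
  have hpos : ∀ t, 0 < t → t < 1 → missCount l' u' t ≤ P + 1 := by
    intro t ht ht'
    have hold := h.pos t ht ht'
    have e1 : (Finset.univ.filter fun z => u' z < t) ⊆
        insert x (Finset.univ.filter fun z => u z < t) := by
      intro z hz
      simp only [Finset.mem_filter, Finset.mem_univ, true_and, Finset.mem_insert,
        hu', Function.update_apply] at hz ⊢
      split_ifs at hz with hzx
      · exact Or.inl hzx
      · exact Or.inr hz
    have e2 : (Finset.univ.filter fun z => t < l' z) ⊆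
        insert y (Finset.univ.filter fun z => t < l z) := by
      intro z hz
      simp only [Finset.mem_filter, Finset.mem_univ, true_and, Finset.mem_insert,
        hl', Function.update_apply] at hz ⊢
      split_ifs at hz with hzx
      · exact Or.inl hzx
      · exact Or.inr hz
    have f1 := (Finset.card_le_card e1).trans (Finset.card_insert_le _ _)
    have f2 := (Finset.card_le_card e2).trans (Finset.card_insert_le _ _)
    -- Only one of `x`, `y` can newly miss `t`, depending on the side of `p` on which `t` lies.
    rcases le_total t p with htp | htp
    · have e3 : (Finset.univ.filter fun z => u' z < t) ⊆
          Finset.univ.filter fun z => u z < t := by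
        intro z hz
        simp only [Finset.mem_filter, Finset.mem_univ, true_and,
          hu', Function.update_apply] at hz ⊢
        split_ifs at hz with hzx
        · linarith
        · exact hz
      have f3 := Finset.card_le_card e3
      unfold missCount at hold ⊢
      omega
    · have e3 : (Finset.univ.filter fun z => t < l' z) ⊆
          Finset.univ.filter fun z => t < l z := by
        intro z hz
        simp only [Finset.mem_filter, Finset.mem_univ, true_and,
          hl', Function.update_apply] at hz ⊢
        split_ifs at hz with hzx
        · linarith
        · exact hz
      have f3 := Finset.card_le_card e3
      unfold missCount at hold ⊢
      omega
  have hu_neg : ∀ t, t < 0 → (Finset.univ.filter fun z => u' z < t) ⊆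
      Finset.univ.filter fun z => u z < t := by
    intro t ht z hz
    simp only [Finset.mem_filter, Finset.mem_univ, true_and,
      hu', Function.update_apply] at hz ⊢
    split_ifs at hz with hzx
    · linarith
    · exact hz
  have hp_one : p < 1 := hux.trans_le (h.bounds x).2
  have hbounds : ∀ v, -1 ≤ l' v ∧ u' v ≤ 1 := by
    intro v
    simp only [hl', hu', Function.update_apply]
    constructor <;> split_ifs
    · linarith
    · exact (h.bounds v).1
    · exact hp_one.le
    · exact (h.bounds v).2
  have hmiss := h.pos p hp0 hp_one
  have hL : (Finset.univ.filter fun z => z ≠ x ∧ z ≠ y ∧ p < l z ∧ l z < u x).card ≤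
      (Finset.univ.filter fun z => p < l z).card :=
    Finset.card_le_card (Finset.monotone_filter_right _ fun z _ hz => hz.2.2.1)
  refine ⟨l', u', hsub, ?_⟩
  rcases lt_or_ge (l y) 0 with hy0 | hy0
  · left
    refine ⟨⟨hlt, hleft, ?_, hbounds, hpos, fun t ht ht' => ?_⟩, ?_⟩
    · have : (Finset.univ.filter fun z => 0 ≤ l' z) =
          insert y (Finset.univ.filter fun z => 0 ≤ l z) := by
        ext z
        simp only [Finset.mem_filter, Finset.mem_univ, true_and, Finset.mem_insert,
          hl', Function.update_apply]
        split_ifs with hz <;> simp [hz, hp0.le]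
      rw [this, Finset.card_insert_of_notMem (by simpa using hy0), h.right]
    · have e2 : (Finset.univ.filter fun z => t < l' z) ⊆
          insert y (Finset.univ.filter fun z => t < l z) := by
        intro z hz
        simp only [Finset.mem_filter, Finset.mem_univ, true_and, Finset.mem_insert,
          hl', Function.update_apply] at hz ⊢
        split_ifs at hz with hzx
        · exact Or.inl hzx
        · exact Or.inr hz
      have f1 := Finset.card_le_card (hu_neg t ht)
      have f2 := (Finset.card_le_card e2).trans (Finset.card_insert_le _ _)
      have hold := h.neg t ht ht'
      unfold missCount at hold ⊢
      omega
    · have hU : (Finset.univ.filter fun z => z ≠ x ∧ z ≠ y ∧ l y < u z ∧ u z < p).card ≤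
          (Finset.univ.filter fun z => u z < p).card :=
        Finset.card_le_card (Finset.monotone_filter_right _ fun z _ hz => hz.2.2.2)
      unfold missCount at hmiss
      omega
  · right
    refine ⟨⟨hlt, hleft, ?_, hbounds, hpos, fun t ht ht' => ?_⟩, ?_⟩
    · rw [← h.right]
      congr 2
      ext z
      simp only [hl', Function.update_apply]
      split_ifs with hz
      · rw [hz]; constructor <;> intro _ <;> linarith
      · rfl
    · have e2 : (Finset.univ.filter fun z => t < l' z) ⊆
          Finset.univ.filter fun z => t < l z := by
        intro z hz
        simp only [Finset.mem_filter, Finset.mem_univ, true_and,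
          hl', Function.update_apply] at hz ⊢
        split_ifs at hz with hzx
        · rw [hzx]; linarith
        · exact hz
      have f1 := Finset.card_le_card (hu_neg t ht)
      have f2 := Finset.card_le_card e2
      have hold := h.neg t ht ht'
      unfold missCount at hold ⊢
      omega
    · have hU : (Finset.univ.filter fun z => z ≠ x ∧ z ≠ y ∧ l y < u z ∧ u z < p).card + a ≤
          (Finset.univ.filter fun z => u z < p).card := by
        rw [← h.left, ← Finset.card_union_of_disjoint]
        · apply Finset.card_le_card
          intro z hz
          simp only [Finset.mem_filter, Finset.mem_univ, true_and, Finset.mem_union] at hz ⊢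
          rcases hz with hz | hz
          · exact hz.2.2.2
          · linarith
        · rw [Finset.disjoint_filter]
          intro z _ hz hz'
          linarith [hz.2.2.1]
      unfold missCount at hmiss
      omega

lemma IsSplit.exists_cut_neg (h : IsSplit l u a c P Q) {x y : Fin n} (hxy : x ≠ y)
    (h1 : l y < u x) (h2 : l x < u y) (hx : l x < 0) (hy : l y < 0) :
    ∃ l' u' : Fin n → ℝ, insert (x, y) (intervalOrder l u) ⊆ intervalOrder l' u' ∧
      ((IsSplit l' u' (a + 1) c (P + 1) (Q + 1) ∧
          (intervalOrder l' u').card ≤ (intervalOrder l u).card + 1 + Q) ∨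
        (IsSplit l' u' a c P (Q + 1) ∧
          (intervalOrder l' u').card + c ≤ (intervalOrder l u).card + 1 + Q)) := by
  obtain ⟨l', u', hsub, hr⟩ := h.reverse.exists_cut_pos hxy.symm (by simpa using h1)
    (by simpa using h2) (by simpa using hy) (by simpa using hx)
  refine ⟨-u', -l', ?_, ?_⟩
  · rw [Finset.insert_subset_iff] at hsub ⊢
    refine ⟨?_, intervalOrder_reverse_subset hsub.2⟩
    rw [← swap_mem_intervalOrder_reverse]
    simpa using hsub.1
  · rw [card_intervalOrder_reverse (l := l') (u := u'),
      ← card_intervalOrder_reverse (l := l) (u := u)]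
    exact hr.imp (fun h => ⟨h.1.reverse, h.2⟩) (fun h => ⟨h.1.reverse, h.2⟩)

end Split

/-! ### One round of OBreaker's strategy -/

/-- An interval order in which `N` vertices are decided. The bounds for the numbers of intervals
missing a positive and a negative point sum up to `N + r` and are balanced, so that each is about
`(N + r) / 2`; here `r` is the number of rounds played so far. -/
def IsBalanced {n : ℕ} (D : Position n) (N r : ℕ) : Prop :=
  ∃ (l u : Fin n → ℝ) (a c P Q : ℕ), IsSplit l u a c P Q ∧ D = intervalOrder l u ∧
    a + c = N ∧ P + Q = N + r ∧ P ≤ Q + 1 ∧ Q ≤ P + 1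

/-- An interval order in which every vertex is decided, with at most `m` vertices on each side. -/
def IsDecided {n : ℕ} (D : Position n) (m : ℕ) : Prop :=
  ∃ l u : Fin n → ℝ, (∀ v, l v < u v) ∧ D = intervalOrder l u ∧ (∀ v, u v ≤ 0 ∨ 0 ≤ l v) ∧
    (Finset.univ.filter fun z => u z ≤ 0).card ≤ m ∧
    (Finset.univ.filter fun z => 0 ≤ l z).card ≤ m

section Round

variable {n : ℕ} {D : Position n} {N r m : ℕ}

lemma IsDecided.mono {k : ℕ} (h : IsDecided D m) (hk : m ≤ k) : IsDecided D k := by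
  obtain ⟨l, u, h1, h2, h3, h4, h5⟩ := h
  exact ⟨l, u, h1, h2, h3, h4.trans hk, h5.trans hk⟩

lemma IsSplit.isDecided {l u : Fin n → ℝ} {a c P Q : ℕ} (h : IsSplit l u a c P Q)
    (hn : a + c = n) (hP : P ≤ m) (hQ : Q ≤ m) : IsDecided (intervalOrder l u) m := by
  refine ⟨l, u, h.lt, rfl, ?_, by rw [h.left]; exact h.left_le.trans hP,
    by rw [h.right]; exact h.right_le.trans hQ⟩
  have : (Finset.univ.filter fun z => u z ≤ 0 ∨ 0 ≤ l z) = Finset.univ := by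
    rw [← Finset.card_eq_iff_eq_univ, Finset.filter_or, Finset.card_union_of_disjoint, h.left,
      h.right, hn, Fintype.card_fin]
    rw [Finset.disjoint_filter]
    intro z _ h1 h2
    linarith [h.lt z]
  intro v
  have hv := Finset.mem_univ v
  rw [← this] at hv
  simpa using hv

lemma IsBalanced.le (h : IsBalanced D N r) : N ≤ n := by
  obtain ⟨l, u, a, c, P, Q, h, -, rfl, -⟩ := h
  exact h.left_add_right_le

lemma isBalanced_empty : IsBalanced (∅ : Position n) 0 0 := by
  refine ⟨fun _ => -1, fun _ => 1, 0, 0, 0, 0, ⟨fun _ => by norm_num, by norm_num,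
    by norm_num, fun _ => by norm_num, fun t _ h => ?_, fun t _ h => ?_⟩, ?_, rfl, rfl, by omega,
    by omega⟩
  · simp [missCount, not_lt.2 h.le, not_lt.2 (by linarith : -1 ≤ t)]
  · simp [missCount, not_lt.2 h.le, not_lt.2 (by linarith : t ≤ 1)]
  · ext e
    simp only [mem_intervalOrder, Finset.notMem_empty, false_iff]
    norm_num

/-- One undecided vertex is moved to the side that keeps the balance. -/
lemma IsBalanced.exists_move (h : IsBalanced D N r) : ∃ D' : Position n, D ⊆ D' ∧
    D'.card ≤ D.card + (N + r + 1) / 2 ∧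
    (IsBalanced D' (N + 1) r ∨ IsDecided D' ((N + r + 1) / 2 + 1)) := by
  obtain ⟨l, u, a, c, P, Q, h, rfl, rfl, hPQ, h1, h2⟩ := h
  have ha := h.left_le
  have hc := h.right_le
  rcases h.eq_or_exists with hn | ⟨v, hl, hu⟩
  · exact ⟨_, subset_rfl, by omega, Or.inr (h.isDecided hn (by omega) (by omega))⟩
  · rcases le_total Q P with hle | hle
    · obtain ⟨l', u', h', hs, hcard⟩ := h.exists_move_right hl hu
      exact ⟨_, hs, by omega, Or.inl ⟨l', u', _, _, _, _, h', rfl, by omega, by omega, by omega,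
        by omega⟩⟩
    · obtain ⟨l', u', h', hs, hcard⟩ := h.exists_move_left hl hu
      exact ⟨_, hs, by omega, Or.inl ⟨l', u', _, _, _, _, h', rfl, by omega, by omega, by omega,
        by omega⟩⟩

/-- One undecided vertex is moved to the right side, and another one to the left side. The price
`N + 1` does not depend on how the `N` decided vertices are distributed over the two sides. -/
lemma IsBalanced.exists_move_pair (h : IsBalanced D N r) : ∃ D' : Position n, D ⊆ D' ∧
    D'.card ≤ D.card + (N + 1) ∧
    (IsBalanced D' (N + 2) r ∨ IsDecided D' ((N + r + 1) / 2 + 1)) := by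
  obtain ⟨l, u, a, c, P, Q, h, rfl, rfl, hPQ, h1, h2⟩ := h
  rcases h.eq_or_exists with hn | ⟨v, hl, hu⟩
  · exact ⟨_, subset_rfl, by omega, Or.inr (h.isDecided hn (by omega) (by omega))⟩
  · obtain ⟨l', u', h', hs, hcard⟩ := h.exists_move_right hl hu
    rcases h'.eq_or_exists with hn | ⟨w, hl', hu'⟩
    · exact ⟨_, hs, by omega, Or.inr (h'.isDecided hn (by omega) (by omega))⟩
    · obtain ⟨l'', u'', h'', hs', hcard'⟩ := h'.exists_move_left hl' hu'
      exact ⟨_, hs.trans hs', by omega, Or.inl ⟨l'', u'', _, _, _, _, h'', rfl, by omega, by omega,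
        by omega, by omega⟩⟩

/-- The answer to the arc `(x, y)`: it decides one vertex and raises both bounds by one. -/
lemma IsBalanced.exists_answer (h : IsBalanced D N r) {x y : Fin n} (hxy : (x, y) ∈ available D) :
    ∃ D' : Position n, insert (x, y) D ⊆ D' ∧ D'.card ≤ D.card + 1 + (N + r + 1) / 2 ∧
    (IsBalanced D' (N + 1) (r + 1) ∨ IsDecided D' ((N + r + 1) / 2 + 1)) := by
  obtain ⟨l, u, a, c, P, Q, h, rfl, rfl, hPQ, h1, h2⟩ := h
  obtain ⟨hne, h3, h4⟩ := lt_of_mem_available hxy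
  by_cases hpos : 0 < u x ∧ 0 < u y
  · obtain ⟨l', u', hs, ⟨h', hcard⟩ | ⟨h', hcard⟩⟩ := h.exists_cut_pos hne h3 h4 hpos.1 hpos.2
    · exact ⟨_, hs, by omega, Or.inl ⟨l', u', _, _, _, _, h', rfl, by omega, by omega, by omega,
        by omega⟩⟩
    · rcases h'.eq_or_exists with hn | ⟨w, hl', hu'⟩
      · exact ⟨_, hs, by omega, Or.inr (h'.isDecided hn (by omega) (by omega))⟩
      · obtain ⟨l'', u'', h'', hs', hcard'⟩ := h'.exists_move_right hl' hu'
        exact ⟨_, hs.trans hs', by omega, Or.inl ⟨l'', u'', _, _, _, _, h'', rfl, by omega,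
          by omega, by omega, by omega⟩⟩
  · have hneg : l x < 0 ∧ l y < 0 := by
      have hx := h.lt x
      have hy := h.lt y
      by_contra hc
      apply hpos
      rcases not_and_or.1 hc with hc | hc <;> rw [not_lt] at hc <;> constructor <;> linarith
    obtain ⟨l', u', hs, ⟨h', hcard⟩ | ⟨h', hcard⟩⟩ := h.exists_cut_neg hne h3 h4 hneg.1 hneg.2
    · exact ⟨_, hs, by omega, Or.inl ⟨l', u', _, _, _, _, h', rfl, by omega, by omega, by omega,
        by omega⟩⟩
    · rcases h'.eq_or_exists with hn | ⟨w, hl', hu'⟩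
      · exact ⟨_, hs, by omega, Or.inr (h'.isDecided hn (by omega) (by omega))⟩
      · obtain ⟨l'', u'', h'', hs', hcard'⟩ := h'.exists_move_left hl' hu'
        exact ⟨_, hs.trans hs', by omega, Or.inl ⟨l'', u'', _, _, _, _, h'', rfl, by omega,
          by omega, by omega, by omega⟩⟩

/-- When all vertices are decided, an undirected edge lies within one side, and the new arcs of a
cut come from different vertices of that side. -/
lemma IsDecided.exists_answer (h : IsDecided D m) {x y : Fin n} (hxy : (x, y) ∈ available D) :
    ∃ D' : Position n, insert (x, y) D ⊆ D' ∧ D'.card + 1 ≤ D.card + m ∧ IsDecided D' m := by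
  obtain ⟨l, u, hlt, rfl, hdec, ha, hc⟩ := h
  obtain ⟨hne, h3, h4⟩ := lt_of_mem_available hxy
  have hI : max (l x) (l y) < min (u x) (u y) := by
    simp only [max_lt_iff, lt_min_iff]
    exact ⟨⟨hlt x, h3⟩, h4, hlt y⟩
  obtain ⟨p, hp1, hp2, hp⟩ := exists_generic_point l u hI
  simp only [max_lt_iff, lt_min_iff] at hp1 hp2
  obtain ⟨hlx, hly⟩ := hp1
  obtain ⟨hux, huy⟩ := hp2
  obtain ⟨hsub, hcard⟩ := cut_subset_card hne hlx hly hux huy hp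
  -- All the vertices involved lie on the same side `S` as `x` and `y`.
  have key : ∀ S : Finset (Fin n), S.card ≤ m → x ∈ S → y ∈ S →
      (∀ z, l y < u z → u z < p → z ∈ S) → (∀ z, p < l z → l z < u x → z ∈ S) →
      (intervalOrder (Function.update l y p) (Function.update u x p)).card + 1 ≤
        (intervalOrder l u).card + m := by
    intro S hS hx hy hU hL
    rw [← Finset.card_union_of_disjoint] at hcard
    · have h1 := Finset.card_le_card (s := _) (t := (S.erase x).erase y)
        (Finset.union_subset
          (fun z hz => by
            simp only [Finset.mem_filter, Finset.mem_univ, true_and] at hz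
            simp only [Finset.mem_erase]
            exact ⟨hz.2.1, hz.1, hU z hz.2.2.1 hz.2.2.2⟩ :
            (Finset.univ.filter fun z => z ≠ x ∧ z ≠ y ∧ l y < u z ∧ u z < p) ⊆ _)
          (fun z hz => by
            simp only [Finset.mem_filter, Finset.mem_univ, true_and] at hz
            simp only [Finset.mem_erase]
            exact ⟨hz.2.1, hz.1, hL z hz.2.2.1 hz.2.2.2⟩ :
            (Finset.univ.filter fun z => z ≠ x ∧ z ≠ y ∧ p < l z ∧ l z < u x) ⊆ _))
      have h2 : ((S.erase x).erase y).card + 1 = (S.erase x).card :=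
        Finset.card_erase_add_one (Finset.mem_erase.2 ⟨hne.symm, hy⟩)
      have h3 := Finset.card_erase_add_one hx
      omega
    · rw [Finset.disjoint_filter]
      intro z _ hz hz'
      linarith [hlt z, hz.2.2.2, hz'.2.2.1]
  refine ⟨_, hsub, ?_, Function.update l y p, Function.update u x p, cut_lt hlt hne hlx huy, rfl, ?_⟩
  · rcases hdec x with hx | hx
    · refine key _ ha (by simpa using hx) ?_ ?_ ?_
      · rcases hdec y with hy | hy
        · simpa using hy
        · linarith
      · intro z _ hz
        simp only [Finset.mem_filter, Finset.mem_univ, true_and]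
        linarith
      · intro z _ hz
        simp only [Finset.mem_filter, Finset.mem_univ, true_and]
        rcases hdec z with h | h
        · exact h
        · linarith
    · have hy : 0 ≤ l y := by
        rcases hdec y with hy | hy
        · linarith
        · exact hy
      refine key _ hc (by simpa using hx) (by simpa using hy) ?_ ?_
      · intro z hz _
        simp only [Finset.mem_filter, Finset.mem_univ, true_and]
        rcases hdec z with h | h
        · linarith
        · exact h
      · intro z hz _
        simp only [Finset.mem_filter, Finset.mem_univ, true_and]
        linarith
  · have hu : ∀ z, Function.update u x p z ≤ 0 ↔ u z ≤ 0 := by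
      intro z
      rw [Function.update_apply]
      split_ifs with hz
      · rw [hz]
        rcases hdec x with hx | hx <;> constructor <;> intro _ <;> linarith
      · rfl
    have hl : ∀ z, 0 ≤ Function.update l y p z ↔ 0 ≤ l z := by
      intro z
      rw [Function.update_apply]
      split_ifs with hz
      · rw [hz]
        rcases hdec y with hy | hy <;> constructor <;> intro _ <;> linarith
      · rfl
    simp only [hu, hl]
    exact ⟨hdec, ha, hc⟩

/-- An upper bound for the number of arcs that OBreaker needs for a round in which `h`
vertices become decided. The answer to OMaker's arc costs about `(N + r) / 2`, and so does
an unpaired move of a vertex, which is made for even `h`; the remaining vertices are moved in pairs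
at a price of about `N` per pair. -/
def roundCost (h N r : ℕ) : ℕ :=
  (N + r + 1) / 2 + (h - 1) / 2 * (N + 5) + if h % 2 = 0 then (N + r + 8) / 2 else 0

lemma IsBalanced.exists_round (hD : IsBalanced D N r) {x y : Fin n} (hxy : (x, y) ∈ available D)
    {h b : ℕ} (h1 : 1 ≤ h) (h6 : h ≤ 6) (hb : roundCost h N r ≤ b) (hm : (N + r + 10) / 2 ≤ b) :
    ∃ D' : Position n, insert (x, y) D ⊆ D' ∧ D'.card ≤ D.card + 1 + b ∧
    (IsBalanced D' (N + h) (r + 1) ∨ IsDecided D' b) := by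
  obtain ⟨D₁, s₁, c₁, h₁ | h₁⟩ := hD.exists_answer hxy
  swap
  · exact ⟨D₁, s₁, by omega, Or.inr (h₁.mono (by omega))⟩
  -- If the undecided vertices run out on the way, the remaining moves are dropped.
  have pairs : ∀ j ≤ 2, ∃ D' : Position n, insert (x, y) D ⊆ D' ∧
      D'.card ≤ D.card + 1 + ((N + r + 1) / 2 + j * (N + 5)) ∧
      (IsBalanced D' (N + 1 + 2 * j) (r + 1) ∨ IsDecided D' b) := by
    intro j hj
    induction j with
    | zero => exact ⟨D₁, s₁, by omega, Or.inl h₁⟩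
    | succ j ih =>
      obtain ⟨D₂, s₂, c₂, h₂ | h₂⟩ := ih (by omega)
      · obtain ⟨D₃, s₃, c₃, h₃⟩ := h₂.exists_move_pair
        refine ⟨D₃, s₂.trans s₃, ?_, h₃.imp id fun h => h.mono (by omega)⟩
        rw [add_one_mul]
        omega
      · refine ⟨D₂, s₂, ?_, Or.inr h₂⟩
        rw [add_one_mul]
        omega
  obtain ⟨D₂, s₂, c₂, h₂⟩ := pairs ((h - 1) / 2) (by omega)
  unfold roundCost at hb
  split_ifs at hb with hpar
  · rcases h₂ with h₂ | h₂
    · obtain ⟨D₃, s₃, c₃, h₃⟩ := h₂.exists_move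
      refine ⟨D₃, s₂.trans s₃, by omega, h₃.imp (fun h' => ?_) fun h => h.mono (by omega)⟩
      convert h' using 1
      omega
    · exact ⟨D₂, s₂, by omega, Or.inr h₂⟩
  · refine ⟨D₂, s₂, by omega, h₂.imp (fun h' => ?_) id⟩
    convert h' using 1
    omega

end Round

/-! ### Counting the rounds -/

/-- The constants of the lines `N = h * r + (offset h / 1000) * n` that bound the number `N` of
decided vertices from below after `r` rounds. The line for `h` carries the bound while `h` vertices
can be decided per round. Up to rounding down, the lines for `h` and `h - 1` meet where
`roundCost h N r` reaches the bias `0.7845 * n`, and `offset 6 = 0` makes the start `N = r = 0`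
lie on the line for `6`. -/
def offset : ℕ → ℕ
  | 1 => 439
  | 2 => 267
  | 3 => 158
  | 4 => 92
  | 5 => 40
  | _ => 0

/-- The positions that OBreaker aims for at the end of each turn: either every vertex is decided
and both sides are small, or enough vertices have been decided for the number of rounds. -/
def IsSafe {n : ℕ} (b : ℕ) (D : Position n) : Prop :=
  (∃ N r h, IsBalanced D N r ∧ 1 ≤ h ∧ h ≤ 6 ∧ offset h * n + 1000 * (h * r) ≤ 1000 * N) ∨
    IsDecided D b

section Game

variable {n : ℕ} {D : Position n} {N r h b : ℕ}

lemma isSafe_empty : IsSafe b (∅ : Position n) :=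
  Or.inl ⟨0, 0, 6, isBalanced_empty, by norm_num, le_rfl, by simp [offset]⟩

/-- Each of the lines bounding `N` from below reaches `N = n` within `0.569 * n` rounds, so that
`N + r` stays below twice the bias. -/
lemma add_le_of_offset_le (hN : N ≤ n) (h1 : 1 ≤ h) (h6 : h ≤ 6)
    (hr : offset h * n + 1000 * (h * r) ≤ 1000 * N) : 1000 * (N + r) ≤ 1569 * n := by
  interval_cases h <;> simp only [offset] at hr <;> omega

/-- If a round with `h` vertices is too expensive on the line for `h`, then the position is beyond
the crossing of this line with the one for `h - 1`. -/
lemma exists_affordable_round (hb : 7845 * n + 10000 * 20 ≤ 10000 * b) (hN : N ≤ n) (h1 : 1 ≤ h)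
    (h6 : h ≤ 6) (hr : offset h * n + 1000 * (h * r) ≤ 1000 * N) :
    ∃ k, 1 ≤ k ∧ k ≤ 6 ∧ offset k * n + 1000 * (k * r) ≤ 1000 * N ∧ roundCost k N r ≤ b := by
  have hsum := add_le_of_offset_le hN h1 h6 hr
  induction h, h1 using Nat.le_induction with
  | base => exact ⟨1, le_rfl, by norm_num, hr, by simp [roundCost]; omega⟩
  | succ h h1 ih =>
    by_cases hcost : roundCost (h + 1) N r ≤ b
    · exact ⟨h + 1, by omega, h6, hr, hcost⟩
    · refine ih (by omega) ?_
      have : h ≤ 5 := by omega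
      interval_cases h <;> simp [roundCost, offset] at hcost hr ⊢ <;> omega

/-- OBreaker has to direct an edge even if nothing is left to be repaired. While there are undecided
vertices, moving them is of use anyway; otherwise OBreaker may direct an arbitrary edge
and answer this arc. -/
lemma IsSafe.exists_ssuperset (hb : 7845 * n + 10000 * 20 ≤ 10000 * b) (hD : IsSafe b D)
    (hav : available D ≠ ∅) : ∃ D' : Position n, D ⊂ D' ∧ D'.card ≤ D.card + b ∧ IsSafe b D' := by
  have decided : IsDecided D b →
      ∃ D' : Position n, D ⊂ D' ∧ D'.card ≤ D.card + b ∧ IsSafe b D' := by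
    intro hD
    obtain ⟨⟨x, y⟩, hxy⟩ := Finset.nonempty_iff_ne_empty.2 hav
    obtain ⟨D', h1, h2, h3⟩ := hD.exists_answer hxy
    refine ⟨D', ?_, by omega, Or.inr h3⟩
    exact (Finset.ssubset_insert (mem_available.1 hxy).2.1).trans_subset h1
  rcases hD with ⟨N, r, h, hD, h1, h6, hr⟩ | hD
  · induction hk : n - N using Nat.strong_induction_on generalizing N with
    | _ k ih =>
      have hsum := add_le_of_offset_le hD.le h1 h6 hr
      obtain ⟨D', hs, hc, hD'⟩ := hD.exists_move
      by_cases hne : D = D'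
      · subst hne
        rcases hD' with hD' | hD'
        · exact ih (n - (N + 1)) (by have := hD'.le; omega) (N + 1) hD' (by omega) rfl
        · exact decided (hD'.mono (by omega))
      · refine ⟨D', Finset.ssubset_iff_subset_ne.2 ⟨hs, hne⟩, by omega, ?_⟩
        rcases hD' with hD' | hD'
        · exact Or.inl ⟨N + 1, r, h, hD', h1, h6, by omega⟩
        · exact Or.inr (hD'.mono (by omega))
  · exact decided hD

lemma IsSafe.exists_answer (hb : 7845 * n + 10000 * 20 ≤ 10000 * b) (hD : IsSafe b D)
    {x y : Fin n} (hxy : (x, y) ∈ available D) :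
    ∃ D' : Position n, insert (x, y) D ⊆ D' ∧ D'.card ≤ D.card + 1 + b ∧ IsSafe b D' := by
  rcases hD with ⟨N, r, h, hD, h1, h6, hr⟩ | hD
  · obtain ⟨k, hk1, hk6, hk, hcost⟩ := exists_affordable_round hb hD.le h1 h6 hr
    have hsum := add_le_of_offset_le hD.le h1 h6 hr
    obtain ⟨D', h3, h4, h5⟩ := hD.exists_round hxy hk1 hk6 hcost (by omega)
    refine ⟨D', h3, h4, h5.imp (fun h5 => ⟨_, _, k, h5, hk1, hk6, ?_⟩) id⟩
    rw [mul_add_one]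
    omega
  · obtain ⟨D', h3, h4, h5⟩ := hD.exists_answer hxy
    exact ⟨D', h3, by omega, Or.inr h5⟩

lemma IsSafe.exists_intervalOrder (hD : IsSafe b D) :
    ∃ l u : Fin n → ℝ, (∀ v, l v < u v) ∧ D = intervalOrder l u := by
  rcases hD with ⟨N, r, h, ⟨l, u, a, c, P, Q, hs, hD, -⟩, -⟩ | ⟨l, u, hlt, hD, -⟩
  · exact ⟨l, u, hs.lt, hD⟩
  · exact ⟨l, u, hlt, hD⟩

/-! ### The game -/

lemma IsSafe.hasWinningStrategy (hb : 7845 * n + 10000 * 20 ≤ 10000 * b) (hD : IsSafe b D) :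
    HasWinningStrategy HasDirectedCycle 1 b .OBreaker .OMaker D := by
  induction hk : Fintype.card (Fin n × Fin n) - D.card using Nat.strong_induction_on
    generalizing D with
  | _ k ih =>
    by_cases hav : available D = ∅
    · obtain ⟨l, u, hlt, hD'⟩ := hD.exists_intervalOrder
      exact .finished _ _ hav (not_hasDirectedCycle_of_subset hlt hD'.subset)
    · refine .opponentTurn _ _ (by simp) hav fun S hS => ?_
      obtain ⟨hSav, -, hS1, hS2⟩ := hS
      simp only [Player.bias] at hS2
      obtain ⟨⟨x, y⟩, rfl⟩ := Finset.card_eq_one.1 (le_antisymm hS2 hS1)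
      rw [Finset.singleton_subset_iff] at hSav
      have hE : D ∪ {(x, y)} = insert (x, y) D := by
        rw [Finset.union_comm, Finset.insert_eq]
      have hEc : (insert (x, y) D).card = D.card + 1 :=
        Finset.card_insert_of_notMem (mem_available.1 hSav).2.1
      rw [hE]
      set E := insert (x, y) D
      obtain ⟨D₁, hs₁, hc₁, h₁⟩ := hD.exists_answer hb hSav
      by_cases havE : available E = ∅
      · obtain ⟨l, u, hlt, rfl⟩ := h₁.exists_intervalOrder
        exact .finished _ _ havE (not_hasDirectedCycle_of_subset hlt hs₁)
      · obtain ⟨D₂, hs₂, hc₂, h₂⟩ :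
            ∃ D₂ : Position n, E ⊂ D₂ ∧ D₂.card ≤ E.card + b ∧ IsSafe b D₂ := by
          by_cases hne : E = D₁
          · rw [← hne] at h₁
            exact h₁.exists_ssuperset hb havE
          · exact ⟨D₁, Finset.ssubset_iff_subset_ne.2 ⟨hs₁, hne⟩, by omega, h₁⟩
        have hlt₂ := Finset.card_lt_card hs₂
        have hun := Finset.card_le_univ D₂
        obtain ⟨l, u, hlt, rfl⟩ := h₂.exists_intervalOrder
        refine .ownTurn _ _ (intervalOrder l u \ E) rfl havE
          (isLegalMove_sdiff hlt hs₂.subset hs₂.ne' hc₂) ?_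
        rw [Finset.union_sdiff_of_subset hs₂.subset]
        exact ih _ (by omega) h₂ rfl

lemma oBreakerWins_of_le (hb : 7845 * n + 10000 * 20 ≤ 10000 * b) : OBreakerWins n b :=
  isSafe_empty.hasWinningStrategy hb

/-- Allowing OBreaker fewer edges per turn does not harm OMaker. -/
lemma HasWinningStrategy.mono_bias {P : Position n → Prop} {a b' : ℕ} {q : Player}
    (h : HasWinningStrategy P a b .OMaker q D) (hb : b' ≤ b) :
    HasWinningStrategy P a b' .OMaker q D := by
  induction h with
  | finished q D hD h => exact .finished q D hD h
  | ownTurn q D S hq hD hS _ ih =>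
    subst hq
    exact .ownTurn _ D S rfl hD hS ih
  | opponentTurn q D hq hD _ ih =>
    refine .opponentTurn q D hq hD fun S hS => ih S ?_
    refine ⟨hS.1, hS.2.1, hS.2.2.1, hS.2.2.2.trans ?_⟩
    cases q
    · exact le_rfl
    · exact hb

lemma HasWinningStrategy.not_opponent {P : Position n → Prop} {a : ℕ} {p q : Player}
    (h : HasWinningStrategy P a b p q D) : ¬ HasWinningStrategy P a b p.opponent q D := by
  induction h with
  | finished q D hD h =>
    intro h'
    cases h' with
    | finished _ _ _ h' => cases p <;> simp_all [Player.winsFinal, Player.opponent]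
    | ownTurn _ _ _ _ hD' => exact hD' hD
    | opponentTurn _ _ _ hD' => exact hD' hD
  | ownTurn q D S hq hD hS _ ih =>
    intro h'
    cases h' with
    | finished _ _ hD' => exact hD hD'
    | ownTurn _ _ _ hq' => cases p <;> simp_all [Player.opponent]
    | opponentTurn _ _ _ _ h' => exact ih (h' S hS)
  | opponentTurn q D hq hD _ ih =>
    intro h'
    cases h' with
    | finished _ _ hD' => exact hD hD'
    | ownTurn _ _ S _ _ hS h' => exact ih S hS h'
    | opponentTurn _ _ hq' => cases p <;> cases q <;> simp_all [Player.opponent]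

lemma OMakerWins.not_le (h : OMakerWins n b) : ¬ 7845 * n + 10000 * 20 ≤ 10000 * b :=
  fun hb => h.not_opponent (oBreakerWins_of_le hb)

lemma bddAbove_oMakerWins (n : ℕ) : BddAbove {b : ℕ | 1 ≤ b ∧ OMakerWins n b} :=
  ⟨n + 20, fun b hb => by have := hb.2.not_le; omega⟩

lemma thresholdBias_mem (h : thresholdBias n ≠ 0) :
    thresholdBias n ∈ {b : ℕ | 1 ≤ b ∧ OMakerWins n b} := by
  refine Nat.sSup_mem ?_ (bddAbove_oMakerWins n)
  by_contra hne
  apply h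
  rw [thresholdBias, Set.not_nonempty_iff_eq_empty.1 hne, csSup_empty]
  rfl

lemma oMakerWins_iff_le_thresholdBias (hb : 1 ≤ b) : OMakerWins n b ↔ b ≤ thresholdBias n :=
  ⟨fun h => le_csSup (bddAbove_oMakerWins n) ⟨hb, h⟩,
    fun h => (thresholdBias_mem (by omega)).2.mono_bias h⟩

end Game

end OrientationGame

/-- There is a constant `C` such that for every `n`: the threshold bias `t(n, 𝒞)` is indeed a
threshold (OMaker wins the monotone `b`-biased Oriented-cycle game on `K_n` if and only if
`b ≤ t(n, 𝒞)`), it is at most `0.7845 n + C`, and OBreaker has a winning strategy for every bias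
`b ≥ 0.7845 n + C`. -/
theorem theorem1 :
    ∃ C : ℝ, ∀ n : ℕ,
      (∀ b : ℕ, 1 ≤ b →
        (OrientationGame.OMakerWins n b ↔ b ≤ OrientationGame.thresholdBias n)) ∧
      (OrientationGame.thresholdBias n : ℝ) ≤ 0.7845 * (n : ℝ) + C ∧
      (∀ b : ℕ, 1 ≤ b → 0.7845 * (n : ℝ) + C ≤ (b : ℝ) →
        OrientationGame.OBreakerWins n b) := by
  refine ⟨20, fun n => ⟨fun b hb => OrientationGame.oMakerWins_iff_le_thresholdBias hb, ?_,
    fun b _ hb => OrientationGame.oBreakerWins_of_le ?_⟩⟩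
  · have h : 10000 * OrientationGame.thresholdBias n ≤ 7845 * n + 10000 * 20 := by
      by_cases h0 : OrientationGame.thresholdBias n = 0
      · omega
      · exact (not_le.1 (OrientationGame.thresholdBias_mem h0).2.not_le).le
    have h' : (10000 : ℝ) * OrientationGame.thresholdBias n ≤ 7845 * n + 10000 * 20 := by
      exact_mod_cast h
    linarith
  · have : (7845 : ℝ) * n + 10000 * 20 ≤ 10000 * b := by linarith
    exact_mod_cast this
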